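/- A \emph{JB$^*$-algebra} is a complex Banach space $\mathcal{J}$ (not assumed to have a unit) with a commutative bilinear product $\circ$ satisfying the Jordan identity $(a\circ b)\circ a^2=a\circ(b\circ a^2)$ and $\|a\circ b\|\le\|a\|\,\|b\|$, and with an isometric conjugate-linear algebra involution $^*$ such that $\|2(a\circ a^*)\circ a-a^2\circ a^*\|=\|a\|^3$ for every $a$. Write $\{a,b,c\}=(a\circ b^*)\circ c+(c\circ b^*)\circ a-(a\circ c)\circ b^*$, and $a\perp b$ if $\{a,b,c\}=0$ for every $c\in\mathcal{J}$. For $a\in\mathcal{J}$ and $\varphi$ in the dual space $\mathcal{J}^*$, let $a\circ\varphi=\varphi\circ a\in\mathcal{J}^*$ be given by $(a\circ\varphi)(b)=\varphi(a\circ b)$. \textbf{Proposition.} Let $\mathcal{J}$ be a JB$^*$-algebra and let $V:\mathcal{J}\times\mathcal{J}\to\mathbb{C}$ be a continuous bilinear form which is anti-symmetric, that is, $V(a,b)=-V(b,a)$ for all $a,b\in\mathcal{J}$, and orthogonal on the self-adjoint part $\mathcal{J}_{sa}$, that is, $V(a,b)=0$ for all $a,b\in\mathcal{J}$ with $a=a^*$,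 $b=b^*$ and $a\perp b$. Then the linear map $D_V:\mathcal{J}\to\mathcal{J}^*$, $D_V(a)(b)=V(a,b)$, is a Jordan derivation, that is, $$D_V(a\circ b)=D_V(a)\circ b+a\circ D_V(b)\qquad\text{for all }a,b\in\mathcal{J}.$$ -/

import Mathlib

/-- A JB*-algebra: a complex Jordan Banach algebra `J` (commutative, not necessarily associative
nor unital, with the Jordan identity; complete, with a submultiplicative norm), with an isometric
conjugate-linear algebra involution such that `‖2 (a ∘ a⋆) ∘ a - a² ∘ a⋆‖ = ‖a‖ ^ 3`.
The Jordan product `a ∘ b` is written `a * b`. -/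
class JBStarAlgebra (J : Type*) extends NormedAddCommGroup J, NonUnitalNonAssocCommRing J,
    NormedSpace ℂ J, CompleteSpace J, IsScalarTower ℂ J J, SMulCommClass ℂ J J,
    IsCommJordan J, StarRing J, StarModule ℂ J where
  norm_mul_le' : ∀ a b : J, ‖a * b‖ ≤ ‖a‖ * ‖b‖
  norm_star' : ∀ a : J, ‖star a‖ = ‖a‖
  norm_triple' : ∀ a : J,
    ‖(2 : ℂ) • ((a * star a) * a) - (a * a) * star a‖ = ‖a‖ ^ 3

namespace JBStarAlgebra

variable {J : Type*} [JBStarAlgebra J]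

/-- The triple product `{a, b, c} = (a ∘ b⋆) ∘ c + (c ∘ b⋆) ∘ a - (a ∘ c) ∘ b⋆`. -/
def triple (a b c : J) : J :=
  (a * star b) * c + (c * star b) * a - (a * c) * star b

/-- Orthogonality `a ⊥ b`: the operator `L(a, b) : c ↦ {a, b, c}` vanishes. -/
def Orthogonal (a b : J) : Prop := ∀ c : J, triple a b c = 0

/-- A form on `J` is a continuous bilinear form `J × J → ℂ`. -/
abbrev Form (J : Type*) [JBStarAlgebra J] : Type _ := J →L[ℂ] J →L[ℂ] ℂ

/-- `V(a, b) = -V(b, a)` for all `a, b`. -/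
def Form.IsAntiSymmetric (V : Form J) : Prop := ∀ a b : J, V a b = -V b a

/-- `V` is orthogonal on `J_sa`: `V(a, b) = 0` for all self-adjoint `a, b` with `a ⊥ b`. -/
def Form.IsOrthogonalOnSelfAdjoint (V : Form J) : Prop :=
  ∀ a b : J, IsSelfAdjoint a → IsSelfAdjoint b → Orthogonal a b → V a b = 0

/-- Multiplication `b ↦ a ∘ b` as a bounded operator on `J`. -/
noncomputable def mulOp (a : J) : J →L[ℂ] J :=
  (LinearMap.mulLeft ℂ a).mkContinuous ‖a‖ (fun b => norm_mul_le' a b)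

@[simp] theorem mulOp_apply (a b : J) : mulOp a b = a * b := rfl

/-- The module product `a ∘ φ = φ ∘ a` of `a ∈ J` and `φ ∈ J*`: `(a ∘ φ)(b) = φ(a ∘ b)`. -/
noncomputable def dualMul (a : J) (φ : StrongDual ℂ J) : StrongDual ℂ J := φ.comp (mulOp a)

@[simp] theorem dualMul_apply (a : J) (φ : StrongDual ℂ J) (b : J) :
    dualMul a φ b = φ (a * b) := rfl

/-- A linear map `D : J → J*` is a Jordan derivation if
`D(a ∘ b) = D(a) ∘ b + a ∘ D(b)` for all `a, b`. -/
def IsJordanDerivation (D : J →ₗ[ℂ] StrongDual ℂ J) : Prop :=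
  ∀ a b : J, D (a * b) = dualMul b (D a) + dualMul a (D b)

/-- The linear map `D_V : J → J*`, `D_V(a)(b) = V(a, b)`. -/
noncomputable def Form.toDual (V : Form J) : J →ₗ[ℂ] StrongDual ℂ J where
  toFun a := V a
  map_add' := map_add V
  map_smul' := map_smul V

@[simp] theorem Form.toDual_apply (V : Form J) (a b : J) : V.toDual a b = V a b := rfl

end JBStarAlgebra

/-! Everything reduces to `V(a, a²) = 0` for self-adjoint `a`. Polarizing this cubic identity gives
`V(a, bc) + V(b, ac) + V(c, ab) = 0`, which by antisymmetry is the derivation rule; complex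
linearity then extends it to `J`.

The closed span of the Jordan powers of `a` is a commutative C⋆-algebra in which a zero product
(with a self-adjoint second factor) implies orthogonality in `J`. There, split `a` with tents of
width `δ` peaked at `x_k`: put `e_k = x_k φ_k(a)`, so that `a ≈ ∑ e_k` and `a² ≈ ∑ x_k e_k`. Only
neighbours interact, so `V(∑ e_k, ∑ x_k e_k) = δ S` with `S = ∑ V(e_k, e_{k+1})`. Testing `V` on `∑
i^k e_k` and `∑ (-i)^k e_k`, bounded independently of `δ`, yields `-2i S`. Hence `S` is bounded and
`V(a, a²) = O(δ)`. -/

section Tridiagonal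

/-- The bilinear expansion of an antisymmetric form along a finite sequence of vectors for which
only neighbours interact. -/
theorem sum_sum_eq_of_antisymm_of_tridiagonal (B : ℕ → ℕ → ℂ) (hanti : ∀ i j, B i j = -B j i)
    (htri : ∀ i j, i + 2 ≤ j → B i j = 0) (c d : ℕ → ℂ) (n : ℕ) :
    ∑ i ∈ Finset.range (n + 1), ∑ j ∈ Finset.range (n + 1), c i * d j * B i j =
      ∑ i ∈ Finset.range n, (c i * d (i + 1) - c (i + 1) * d i) * B i (i + 1) := by
  have hdiag : ∀ i, B i i = 0 := fun i => self_eq_neg.mp (hanti i i)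
  induction n with
  | zero => simp [hdiag]
  | succ n ih =>
    rw [Finset.sum_range_succ, Finset.sum_range_succ (fun j => c (n + 1) * d j * B (n + 1) j)]
    simp_rw [Finset.sum_range_succ _ (n + 1)]
    rw [Finset.sum_add_distrib, ih, hdiag]
    have h1 : ∑ i ∈ Finset.range (n + 1), c i * d (n + 1) * B i (n + 1) =
        c n * d (n + 1) * B n (n + 1) := by
      rw [Finset.sum_range_succ, Finset.sum_eq_zero, zero_add]
      intro i hi
      rw [htri i (n + 1) (by have := Finset.mem_range.mp hi; omega), mul_zero]
    have h2 : ∑ j ∈ Finset.range (n + 1), c (n + 1) * d j * B (n + 1) j =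
        c (n + 1) * d n * B (n + 1) n := by
      rw [Finset.sum_range_succ, Finset.sum_eq_zero, zero_add]
      intro i hi
      rw [hanti, htri i (n + 1) (by have := Finset.mem_range.mp hi; omega), neg_zero, mul_zero]
    rw [h1, h2, Finset.sum_range_succ _ n, hanti (n + 1) n]
    ring

end Tridiagonal

/-! ### Piecewise linear partition of unity on the line -/

section Tent

/-- The ramp that is `0` up to `k - 1` and `1` from `k` on. -/
noncomputable def ramp (k t : ℝ) : ℝ := max 0 (min 1 (t - k + 1))

theorem continuous_ramp (k : ℝ) : Continuous (ramp k) := by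
  unfold ramp; fun_prop

theorem ramp_eq_zero {k t : ℝ} (h : t ≤ k - 1) : ramp k t = 0 :=
  max_eq_left (min_le_of_right_le (by linarith))

theorem ramp_eq_one {k t : ℝ} (h : k ≤ t) : ramp k t = 1 := by
  rw [ramp, min_eq_left (by linarith), max_eq_right zero_le_one]

/-- The tent function of height one with peak `k` and support `[k - 1, k + 1]`. -/
noncomputable def tent (k t : ℝ) : ℝ := ramp k t - ramp (k + 1) t

theorem continuous_tent (k : ℝ) : Continuous (tent k) :=
  (continuous_ramp k).sub (continuous_ramp (k + 1))

theorem tent_nonneg (k t : ℝ) : 0 ≤ tent k t :=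
  sub_nonneg.mpr (max_le_max_left _ (min_le_min_left _ (by linarith)))

theorem tent_eq_zero {k t : ℝ} (h : 1 ≤ |t - k|) : tent k t = 0 := by
  rcases le_abs'.mp h with h | h
  · rw [tent, ramp_eq_zero (by linarith), ramp_eq_zero (by linarith), sub_zero]
  · rw [tent, ramp_eq_one (by linarith), ramp_eq_one (by linarith), sub_self]

theorem tent_mul_tent {k l : ℝ} (h : k + 2 ≤ l) (t : ℝ) : tent k t * tent l t = 0 := by
  rcases le_total (k + 1) t with ht | ht
  · rw [tent_eq_zero (le_abs.mpr (Or.inl (by linarith))), zero_mul]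
  · rw [tent_eq_zero (k := l) (le_abs.mpr (Or.inr (by linarith))), mul_zero]

theorem sum_tent {N : ℕ} {t : ℝ} (ht : |t| ≤ N) :
    ∑ k ∈ Finset.range (2 * N + 1), tent ((k : ℝ) - N) t = 1 := by
  obtain ⟨h1, h2⟩ := abs_le.mp ht
  have h : ∀ k ∈ Finset.range (2 * N + 1), tent ((k : ℝ) - N) t =
      ramp ((k : ℝ) - N) t - ramp (((k + 1 : ℕ) : ℝ) - N) t := by
    intro k _
    rw [tent]; push_cast; ring_nf
  rw [Finset.sum_congr rfl h, Finset.sum_range_sub' (fun k : ℕ => ramp ((k : ℝ) - N) t),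
    ramp_eq_one (by push_cast; linarith), ramp_eq_zero (by push_cast; linarith), sub_zero]

/-- Averages against the tents approximate point values. -/
theorem norm_sum_mul_tent_le {N : ℕ} {t C : ℝ} (ht : |t| ≤ N) (c : ℕ → ℂ)
    (hc : ∀ k ∈ Finset.range (2 * N + 1), |t - ((k : ℝ) - N)| ≤ 1 → ‖c k‖ ≤ C) :
    ‖∑ k ∈ Finset.range (2 * N + 1), c k * (tent ((k : ℝ) - N) t : ℂ)‖ ≤ C := by
  calc _ ≤ ∑ k ∈ Finset.range (2 * N + 1), C * tent ((k : ℝ) - N) t := by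
        refine norm_sum_le_of_le _ fun k hk => ?_
        rw [norm_mul, Complex.norm_real, Real.norm_of_nonneg (tent_nonneg _ _)]
        rcases le_total |t - ((k : ℝ) - N)| 1 with h | h
        · exact mul_le_mul_of_nonneg_right (hc k hk h) (tent_nonneg _ _)
        · rw [tent_eq_zero h, mul_zero, mul_zero]
    _ = C := by rw [← Finset.mul_sum, sum_tent ht, mul_one]

end Tent

/-! ### Antisymmetric orthogonal forms on commutative C⋆-algebras -/

section CStar

variable {A : Type*} [NonUnitalCommCStarAlgebra A]

/-- The function `z ↦ x φ (z)`, where `φ` is the tent of width `δ` with peak `x = δ (k - N)`. -/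
noncomputable def tentFun (N : ℕ) (δ : ℝ) (k : ℕ) (z : ℂ) : ℂ :=
  ((δ * ((k : ℝ) - N) : ℝ) : ℂ) * (tent ((k : ℝ) - N) (z.re / δ) : ℂ)

theorem continuous_tentFun (N : ℕ) (δ : ℝ) (k : ℕ) : Continuous (tentFun N δ k) := by
  have := continuous_tent ((k : ℝ) - N)
  unfold tentFun
  fun_prop

/-- The factor `x` kills the only tent that is nonzero at the origin, so the non-unital functional
calculus applies. -/
theorem tentFun_zero (N : ℕ) (δ : ℝ) (k : ℕ) : tentFun N δ k 0 = 0 := by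
  rcases eq_or_ne k N with rfl | h
  · simp [tentFun]
  · have h1 : (1 : ℝ) ≤ |0 - ((k : ℝ) - N)| := by
      have h2 : 1 ≤ |(0 : ℤ) - ((k : ℤ) - N)| := Int.one_le_abs (by omega)
      exact_mod_cast h2
    simp only [tentFun, Complex.zero_re, zero_div, tent_eq_zero h1, Complex.ofReal_zero, mul_zero]

theorem star_tentFun (N : ℕ) (δ : ℝ) (k : ℕ) (z : ℂ) :
    star (tentFun N δ k z) = tentFun N δ k z := by
  simp [tentFun, -Complex.ofReal_mul, -Complex.ofReal_sub]

theorem tentFun_mul_tentFun (N : ℕ) (δ : ℝ) {k l : ℕ} (h : k + 2 ≤ l) (z : ℂ) :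
    tentFun N δ k z * tentFun N δ l z = 0 := by
  have h' : (k : ℝ) - N + 2 ≤ (l : ℝ) - N := by
    have : ((k + 2 : ℕ) : ℝ) ≤ l := by exact_mod_cast h
    push_cast at this; linarith
  have := tent_mul_tent h' (z.re / δ)
  rw [tentFun, tentFun, mul_mul_mul_comm, ← Complex.ofReal_mul (tent _ _), this,
    Complex.ofReal_zero, mul_zero]

theorem isSelfAdjoint_cfcₙ_tentFun (N : ℕ) (δ : ℝ) (k : ℕ) (a : A) :
    IsSelfAdjoint (cfcₙ (tentFun N δ k) a) := by
  rw [IsSelfAdjoint, ← cfcₙ_star]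
  simp only [star_tentFun]

theorem cfcₙ_tentFun_mul (N : ℕ) (δ : ℝ) {k l : ℕ} (h : k + 2 ≤ l) (a : A) :
    cfcₙ (tentFun N δ k) a * cfcₙ (tentFun N δ l) a = 0 := by
  rw [← cfcₙ_mul (tentFun N δ k) (tentFun N δ l) a (continuous_tentFun N δ k).continuousOn
    (tentFun_zero N δ k) (continuous_tentFun N δ l).continuousOn (tentFun_zero N δ l)]
  simp only [tentFun_mul_tentFun N δ h, cfcₙ_const_zero]

theorem sum_smul_cfcₙ_tentFun (N : ℕ) (δ : ℝ) (c : ℕ → ℂ) (a : A) :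
    ∑ k ∈ Finset.range (2 * N + 1), c k • cfcₙ (tentFun N δ k) a =
      cfcₙ (fun z => ∑ k ∈ Finset.range (2 * N + 1), c k * tentFun N δ k z) a := by
  have hc := fun k => (continuous_tentFun N δ k)
  have := cfcₙ_sum (fun k z => c k * tentFun N δ k z) a (Finset.range (2 * N + 1))
    (fun k _ => ((hc k).const_mul (c k)).continuousOn) (fun k _ => by simp [tentFun_zero])
  have h2 : (fun z => ∑ k ∈ Finset.range (2 * N + 1), c k * tentFun N δ k z) =
      ∑ k ∈ Finset.range (2 * N + 1), fun z => c k * tentFun N δ k z := by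
    ext z; simp
  rw [h2, this]
  refine Finset.sum_congr rfl fun k _ => ?_
  rw [cfcₙ_const_mul (c k) _ a (hc k).continuousOn (tentFun_zero N δ k)]

theorem IsSelfAdjoint.abs_re_le_norm_of_mem_quasispectrum {a : A} (ha : IsSelfAdjoint a) {z : ℂ}
    (hz : z ∈ quasispectrum ℂ a) : |z.re| ≤ ‖a‖ :=
  (Complex.abs_re_le_norm z).trans (NonUnitalIsometricContinuousFunctionalCalculus.norm_quasispectrum_le a hz ha.isStarNormal)

theorem IsSelfAdjoint.coe_re_eq_of_mem_quasispectrum {a : A} (ha : IsSelfAdjoint a) {z : ℂ}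
    (hz : z ∈ quasispectrum ℂ a) : (z.re : ℂ) = z := by
  have h := (cfcₙ_eq_cfcₙ_iff_eqOn (R := ℂ) (f := (star · : ℂ → ℂ)) (g := id) ha.isStarNormal).mp
    (by rw [cfcₙ_star_id (R := ℂ) a ha.isStarNormal, cfcₙ_id ℂ a ha.isStarNormal, ha.star_eq]) hz
  exact Complex.conj_eq_iff_re.mp h

section Approx

variable {N : ℕ} {δ : ℝ} {a : A}

/-- On the spectrum the sum is a tent-weighted average of the numbers `c_k x_k`, each of modulus at
most `δN`; the bound survives refining the mesh with `δN` fixed. -/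
theorem norm_sum_smul_cfcₙ_tentFun_le (hδ : 0 < δ) (ha : IsSelfAdjoint a)
    (haN : ‖a‖ ≤ δ * N) (c : ℕ → ℂ) (hc : ∀ k, ‖c k‖ ≤ 1) :
    ‖∑ k ∈ Finset.range (2 * N + 1), c k • cfcₙ (tentFun N δ k) a‖ ≤ δ * N := by
  rw [sum_smul_cfcₙ_tentFun]
  refine norm_cfcₙ_le fun z hz => ?_
  have hzN : |z.re / δ| ≤ N := by
    rw [abs_div, abs_of_pos hδ, div_le_iff₀ hδ, mul_comm]
    exact (ha.abs_re_le_norm_of_mem_quasispectrum hz).trans haN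
  simp only [tentFun, ← mul_assoc]
  refine norm_sum_mul_tent_le hzN (fun k => c k * ((δ * ((k : ℝ) - N) : ℝ) : ℂ)) fun k hk _ => ?_
  rw [norm_mul, Complex.norm_real, Real.norm_eq_abs, abs_mul, abs_of_pos hδ]
  have : |(k : ℝ) - N| ≤ N := by
    have : (k : ℝ) ≤ 2 * N := by exact_mod_cast Nat.lt_succ_iff.mp (Finset.mem_range.mp hk)
    exact abs_le.mpr ⟨by linarith [Nat.cast_nonneg (α := ℝ) k], by linarith⟩
  calc _ ≤ 1 * (δ * N) := by gcongr; exact hc k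
    _ = _ := one_mul _

theorem norm_sub_sum_cfcₙ_tentFun_le (hδ : 0 < δ) (ha : IsSelfAdjoint a) (haN : ‖a‖ ≤ δ * N)
    (f : ℂ → ℂ) (hf : Continuous f) (hf0 : f 0 = 0) (c : ℕ → ℂ) {C : ℝ}
    (hc : ∀ k ∈ Finset.range (2 * N + 1), ∀ t : ℝ, |t| ≤ δ * N → |t - δ * ((k : ℝ) - N)| ≤ δ →
      ‖f t - c k * ((δ * ((k : ℝ) - N) : ℝ) : ℂ)‖ ≤ C) :
    ‖cfcₙ f a - ∑ k ∈ Finset.range (2 * N + 1), c k • cfcₙ (tentFun N δ k) a‖ ≤ C := by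
  have hcont : Continuous fun z => ∑ k ∈ Finset.range (2 * N + 1), c k * tentFun N δ k z := by
    have := continuous_tentFun N δ
    fun_prop
  rw [sum_smul_cfcₙ_tentFun, ← cfcₙ_sub f _ a hf.continuousOn hf0 hcont.continuousOn
    (by simp [tentFun_zero])]
  refine norm_cfcₙ_le fun z hz => ?_
  have hz' := (ha.abs_re_le_norm_of_mem_quasispectrum hz).trans haN
  have hzN : |z.re / δ| ≤ N := by
    rwa [abs_div, abs_of_pos hδ, div_le_iff₀ hδ, mul_comm]
  have hone : f z = ∑ k ∈ Finset.range (2 * N + 1),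
      f (z.re : ℂ) * (tent ((k : ℝ) - N) (z.re / δ) : ℂ) := by
    rw [← Finset.mul_sum, ← Complex.ofReal_sum, sum_tent hzN, Complex.ofReal_one, mul_one,
      ha.coe_re_eq_of_mem_quasispectrum hz]
  rw [hone, ← Finset.sum_sub_distrib]
  simp only [tentFun, ← mul_assoc, ← sub_mul]
  refine norm_sum_mul_tent_le hzN
    (fun k => f (z.re : ℂ) - c k * ((δ * ((k : ℝ) - N) : ℝ) : ℂ)) fun k hk h => ?_
  refine hc k hk z.re hz' ?_
  have : z.re - δ * ((k : ℝ) - N) = δ * (z.re / δ - ((k : ℝ) - N)) := by field_simp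
  rw [this, abs_mul, abs_of_pos hδ]
  exact mul_le_of_le_one_right hδ.le h

theorem norm_sub_sum_tentFun_le (hδ : 0 < δ) (ha : IsSelfAdjoint a) (haN : ‖a‖ ≤ δ * N) :
    ‖a - ∑ k ∈ Finset.range (2 * N + 1), (1 : ℂ) • cfcₙ (tentFun N δ k) a‖ ≤ δ := by
  have := norm_sub_sum_cfcₙ_tentFun_le hδ ha haN id continuous_id rfl (fun _ => 1) (C := δ)
    fun k _ t _ h => by
      rw [one_mul, id, ← Complex.ofReal_sub, Complex.norm_real]
      exact h
  rwa [cfcₙ_id ℂ a ha.isStarNormal] at this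

theorem norm_mul_self_sub_sum_tentFun_le (hδ : 0 < δ) (ha : IsSelfAdjoint a)
    (haN : ‖a‖ ≤ δ * N) :
    ‖a * a - ∑ k ∈ Finset.range (2 * N + 1),
      ((δ * ((k : ℝ) - N) : ℝ) : ℂ) • cfcₙ (tentFun N δ k) a‖ ≤ δ * (2 * (δ * N)) := by
  have := norm_sub_sum_cfcₙ_tentFun_le hδ ha haN (fun z => z * z) (by fun_prop) (mul_zero _)
    (fun k => ((δ * ((k : ℝ) - N) : ℝ) : ℂ)) (C := δ * (2 * (δ * N)))
    fun k hk t ht h => by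
      rw [← Complex.ofReal_mul, ← Complex.ofReal_mul, ← Complex.ofReal_sub, Complex.norm_real,
        Real.norm_eq_abs, mul_self_sub_mul_self, mul_comm, abs_mul]
      have h1 : (k : ℝ) ≤ 2 * N := by
        exact_mod_cast Nat.lt_succ_iff.mp (Finset.mem_range.mp hk)
      have h2 : |δ * ((k : ℝ) - N)| ≤ δ * N := by
        rw [abs_mul, abs_of_pos hδ]
        gcongr
        exact abs_le.mpr ⟨by linarith [Nat.cast_nonneg (α := ℝ) k], by linarith⟩
      have h3 := abs_add_le t (δ * ((k : ℝ) - N))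
      gcongr
      linarith
  have hid := cfcₙ_id' ℂ a ha.isStarNormal
  rwa [cfcₙ_mul (fun z : ℂ => z) (fun z => z) a, hid] at this

end Approx

/-- A bounded antisymmetric bilinear form on a commutative C⋆-algebra vanishing at pairs of
self-adjoint elements with zero product vanishes at `(a, a²)` for self-adjoint `a`. -/
theorem apply_mul_self_eq_zero_of_antisymm_of_orthogonal (W : A →L[ℂ] A →L[ℂ] ℂ)
    (hanti : ∀ x y, W x y = -W y x)
    (horth : ∀ x y, IsSelfAdjoint x → IsSelfAdjoint y → x * y = 0 → W x y = 0)
    {a : A} (ha : IsSelfAdjoint a) : W a (a * a) = 0 := by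
  -- The summand 1 keeps the mesh `δ = M / N` positive even when `a = 0`.
  set M : ℝ := ‖a‖ + 1 with hM
  have hMpos : 0 < M := by positivity
  have key : ∀ N : ℕ, 0 < N →
      ‖W a (a * a)‖ ≤ (‖W‖ * (‖a * a‖ + 2 * M ^ 2 + M ^ 2)) * (M * (1 / (N : ℝ))) := by
    intro N hN
    have hN' : (0 : ℝ) < N := by exact_mod_cast hN
    set δ : ℝ := M / N with hδdef
    have hδ : 0 < δ := by positivity
    have hδN : δ * N = M := by rw [hδdef]; field_simp
    have haN : ‖a‖ ≤ δ * N := by rw [hδN, hM]; linarith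
    set e : ℕ → A := fun k => cfcₙ (tentFun N δ k) a with he
    set x : ℕ → ℂ := fun k => ((δ * ((k : ℝ) - N) : ℝ) : ℂ) with hx
    have hexp : ∀ c d : ℕ → ℂ, W (∑ k ∈ Finset.range (2 * N + 1), c k • e k)
        (∑ k ∈ Finset.range (2 * N + 1), d k • e k) =
        ∑ i ∈ Finset.range (2 * N), (c i * d (i + 1) - c (i + 1) * d i) * W (e i) (e (i + 1)) := by
      intro c d
      rw [← sum_sum_eq_of_antisymm_of_tridiagonal (fun i j => W (e i) (e j))
        (fun i j => hanti _ _) (fun i j h => horth _ _ (isSelfAdjoint_cfcₙ_tentFun N δ i a)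
          (isSelfAdjoint_cfcₙ_tentFun N δ j a) (cfcₙ_tentFun_mul N δ h a))]
      simp only [map_sum, map_smul, sum_apply, smul_apply,
        smul_eq_mul, mul_assoc, Finset.mul_sum]
      rw [Finset.sum_comm]
      refine Finset.sum_congr rfl fun i _ => Finset.sum_congr rfl fun j _ => ?_
      ring
    set S : ℂ := ∑ i ∈ Finset.range (2 * N), W (e i) (e (i + 1)) with hS
    have h1 : W (∑ k ∈ Finset.range (2 * N + 1), (1 : ℂ) • e k)
        (∑ k ∈ Finset.range (2 * N + 1), x k • e k) = δ * S := by
      rw [hexp (fun _ => 1) x, hS, Finset.mul_sum]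
      refine Finset.sum_congr rfl fun i _ => ?_
      congr 1
      simp only [hx]
      push_cast
      ring
    -- Unimodular coefficients chosen so that `c_i d_{i+1} - c_{i+1} d_i` is the constant `-2i`.
    have h2 : W (∑ k ∈ Finset.range (2 * N + 1), (Complex.I ^ k) • e k)
        (∑ k ∈ Finset.range (2 * N + 1), ((-Complex.I) ^ k) • e k) = (-2 * Complex.I) * S := by
      rw [hexp, hS, Finset.mul_sum]
      refine Finset.sum_congr rfl fun i _ => ?_
      congr 1
      have : Complex.I ^ i * (-Complex.I) ^ i = 1 := by rw [← mul_pow]; simp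
      rw [pow_succ, pow_succ]
      linear_combination (-2 * Complex.I) * this
    have hb := fun c hc => norm_sum_smul_cfcₙ_tentFun_le hδ ha haN c hc
    rw [hδN] at hb
    have hSb : ‖S‖ ≤ ‖W‖ * M ^ 2 := by
      have h3 := W.le_opNorm₂ (∑ k ∈ Finset.range (2 * N + 1), (Complex.I ^ k) • e k)
        (∑ k ∈ Finset.range (2 * N + 1), ((-Complex.I) ^ k) • e k)
      rw [h2, norm_mul] at h3
      have h4 : ‖(-2 * Complex.I : ℂ)‖ = 2 := by simp
      rw [h4] at h3
      have h5 : ‖W‖ * ‖∑ k ∈ Finset.range (2 * N + 1), (Complex.I ^ k) • e k‖ *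
          ‖∑ k ∈ Finset.range (2 * N + 1), ((-Complex.I) ^ k) • e k‖ ≤ ‖W‖ * M * M := by
        gcongr
        · exact hb _ fun k => by simp
        · exact hb _ fun k => by simp
      nlinarith [norm_nonneg S]
    set p := ∑ k ∈ Finset.range (2 * N + 1), (1 : ℂ) • e k with hp
    set q := ∑ k ∈ Finset.range (2 * N + 1), x k • e k with hq
    have hap : ‖a - p‖ ≤ δ := norm_sub_sum_tentFun_le hδ ha haN
    have haq : ‖a * a - q‖ ≤ δ * (2 * M) := by
      have := norm_mul_self_sub_sum_tentFun_le hδ ha haN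
      rwa [hδN] at this
    have hpM : ‖p‖ ≤ M := hb (fun _ => 1) fun _ => by simp
    have hdec : W a (a * a) = W (a - p) (a * a) + W p (a * a - q) + δ * S := by
      rw [← h1]; simp only [map_sub, sub_apply]; ring
    calc ‖W a (a * a)‖ ≤ ‖W (a - p) (a * a)‖ + ‖W p (a * a - q)‖ + ‖(δ : ℂ) * S‖ := by
          rw [hdec]; exact norm_add₃_le
      _ ≤ ‖W‖ * δ * ‖a * a‖ + ‖W‖ * M * (δ * (2 * M)) + δ * (‖W‖ * M ^ 2) := by
          rw [norm_mul, Complex.norm_real, Real.norm_of_nonneg hδ.le]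
          gcongr
          · exact (W.le_opNorm₂ _ _).trans (by gcongr)
          · exact (W.le_opNorm₂ _ _).trans (by gcongr)
      _ = _ := by rw [hδdef]; ring
  have hlim : Filter.Tendsto
      (fun n : ℕ => (‖W‖ * (‖a * a‖ + 2 * M ^ 2 + M ^ 2)) * (M * (1 / ((n : ℝ) + 1))))
      Filter.atTop (nhds 0) := by
    simpa using (tendsto_one_div_add_atTop_nhds_zero_nat.const_mul M).const_mul
      (‖W‖ * (‖a * a‖ + 2 * M ^ 2 + M ^ 2))
  refine norm_le_zero_iff.mp (ge_of_tendsto' hlim fun n => ?_)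
  have := key (n + 1) n.succ_pos
  push_cast at this
  exact this

end CStar

/-! ### Power associativity of Jordan rings -/

section JordanPowers

variable {J : Type*} [NonUnitalNonAssocCommRing J] [IsCommJordan J]

/-- `jordanPow a n` is the Jordan power `a ^ (n + 1)`. -/
def jordanPow (a : J) : ℕ → J
  | 0 => a
  | n + 1 => a * jordanPow a n

variable [IsAddTorsionFree J]

-- The linearized Jordan identity, with its factor 2 cancelled by torsion-freeness.
attribute [local instance 100] LieRing.ofAssociativeRing in
theorem mul_mul_mul_eq (a b c d : J) :
    a * b * d * c = a * b * (d * c) + b * c * (a * d) + c * a * (b * d)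
      - a * (b * c * d) - b * (c * a * d) := by
  have h := DFunLike.congr_fun (two_nsmul_lie_lmul_lmul_add_add_eq_zero a b c) d
  have h2 := (nsmul_right_injective two_ne_zero) (h.trans (nsmul_zero 2).symm)
  have h3 : a * (b * c * d) - b * c * (a * d) + (b * (c * a * d) - c * a * (b * d)) +
    (c * (a * b * d) - a * b * (c * d)) = 0 := h2
  rw [mul_comm (a * b * d) c, mul_comm d c, ← sub_eq_zero, ← h3]
  abel

local notation "L" => AddMonoid.End.mulLeft

theorem commute_mulLeft_jordanPow {a : J} {T : AddMonoid.End J} (h1 : Commute T (L a))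
    (h2 : Commute T (L (a * a))) (n : ℕ) : Commute T (L (jordanPow a n)) := by
  induction n using Nat.strong_induction_on with
  | _ n ih =>
    match n with
    | 0 => exact h1
    | 1 => exact h2
    | n + 2 =>
      have hn := ih n (by omega)
      have hn1 := ih (n + 1) (by omega)
      -- The linearized identity makes this multiplication a polynomial in `L a`, `L (a * a)` and
      -- multiplications by lower powers.
      have key : L (jordanPow a (n + 2)) = L (jordanPow a (n + 1)) * L a
          + L (a * a) * L (jordanPow a n) + L (jordanPow a (n + 1)) * L a
          - L a * (L a * L (jordanPow a n)) - L (jordanPow a n) * (L a * L a) := by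
        ext c
        have := mul_mul_mul_eq a (jordanPow a n) c a
        rw [mul_comm (a * jordanPow a n) a, mul_comm (jordanPow a n * c) (a * a),
          mul_comm (c * a) (jordanPow a n * a), mul_comm c a, mul_comm (jordanPow a n) a,
          mul_comm (jordanPow a n * c) a, mul_comm (a * c) a] at this
        exact this
      rw [key]
      exact (((((hn1.mul_right h1).add_right (h2.mul_right hn)).add_right
        (hn1.mul_right h1)).sub_right (h1.mul_right (h1.mul_right hn))).sub_right
        (hn.mul_right (h1.mul_right h1)))

theorem commute_mulLeft_jordanPow_jordanPow (a : J) (m n : ℕ) :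
    Commute (L (jordanPow a m)) (L (jordanPow a n)) := by
  have h := commute_lmul_lmul_sq a
  exact commute_mulLeft_jordanPow
    (commute_mulLeft_jordanPow (Commute.refl (L a)) h m).symm
    (commute_mulLeft_jordanPow h.symm (Commute.refl (L (a * a))) m).symm n

theorem jordanPow_mul_left_comm (a : J) (m n : ℕ) (x : J) :
    jordanPow a m * (jordanPow a n * x) = jordanPow a n * (jordanPow a m * x) :=
  DFunLike.congr_fun (commute_mulLeft_jordanPow_jordanPow a m n) x

theorem jordanPow_mul_jordanPow (a : J) (m n : ℕ) :
    jordanPow a m * jordanPow a n = jordanPow a (m + n + 1) := by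
  induction n with
  | zero => exact mul_comm _ _
  | succ n ih =>
    have := jordanPow_mul_left_comm a m 0 (jordanPow a n)
    change jordanPow a m * (a * _) = a * _ at this
    change jordanPow a m * (a * _) = a * _
    rw [this, ih]
    rfl

end JordanPowers

/-! ### The commutative C⋆-algebra generated by a self-adjoint element -/

namespace JBStarAlgebra

variable {J : Type*} [JBStarAlgebra J]

instance : IsAddTorsionFree J := .of_isTorsionFree ℂ J

theorem continuous_mul_pair : Continuous fun p : J × J => p.1 * p.2 := by
  have h : IsBoundedBilinearMap ℂ fun p : J × J => p.1 * p.2 :=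
    { add_left := add_mul
      smul_left := smul_mul_assoc
      add_right := mul_add
      smul_right := fun c x y => mul_smul_comm c x y
      bound := ⟨1, one_pos, fun x y => by rw [one_mul]; exact norm_mul_le' x y⟩ }
  exact h.continuous

instance : ContinuousMul J := ⟨continuous_mul_pair⟩

instance : NormedStarGroup J := ⟨fun a => (norm_star' a).le⟩

/-- The closed linear span of the Jordan powers of `a`. -/
noncomputable def powerSpan (a : J) : Submodule ℂ J :=
  (Submodule.span ℂ (Set.range (jordanPow a))).topologicalClosure

theorem self_mem_powerSpan (a : J) : a ∈ powerSpan a :=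
  Submodule.le_topologicalClosure _ (Submodule.subset_span ⟨0, rfl⟩)

/-- A closed linear condition holds on `powerSpan a` if it holds at the powers of `a`. -/
theorem powerSpan_le {a : J} {S : Submodule ℂ J} (hS : IsClosed (S : Set J))
    (h : ∀ n, jordanPow a n ∈ S) : powerSpan a ≤ S :=
  Submodule.topologicalClosure_minimal _
    (Submodule.span_le.mpr (Set.range_subset_iff.mpr h)) hS

theorem isClosed_powerSpan (a : J) : IsClosed (powerSpan a : Set J) :=
  Submodule.isClosed_topologicalClosure _

theorem jordanPow_mem_powerSpan (a : J) (n : ℕ) : jordanPow a n ∈ powerSpan a :=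
  Submodule.le_topologicalClosure _ (Submodule.subset_span ⟨n, rfl⟩)

theorem mul_mem_powerSpan {a x y : J} (hx : x ∈ powerSpan a) (hy : y ∈ powerSpan a) :
    x * y ∈ powerSpan a := by
  have h1 : ∀ n, ∀ y ∈ powerSpan a, jordanPow a n * y ∈ powerSpan a := fun n y hy =>
    powerSpan_le (S := (powerSpan a).comap (mulOp (jordanPow a n)).toLinearMap)
      ((isClosed_powerSpan a).preimage (mulOp (jordanPow a n)).continuous)
      (fun m => by
        change jordanPow a n * jordanPow a m ∈ powerSpan a
        rw [jordanPow_mul_jordanPow]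
        exact jordanPow_mem_powerSpan a _) hy
  have h2 := powerSpan_le (a := a) (S := (powerSpan a).comap (mulOp y).toLinearMap)
    ((isClosed_powerSpan a).preimage (mulOp y).continuous) (fun n => by
        change y * jordanPow a n ∈ powerSpan a
        rw [mul_comm]
        exact h1 n y hy) hx
  rw [mul_comm]
  exact h2

/-- Here `z` ranges over all of `J`: this is operator commutation, stronger than associativity of
the span, and orthogonality in `J` needs it. -/
theorem mul_left_comm_of_mem_powerSpan {a x y : J} (hx : x ∈ powerSpan a) (hy : y ∈ powerSpan a)
    (z : J) : x * (y * z) = y * (x * z) := by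
  have closedEq : ∀ y z : J, IsClosed {x : J | x * (y * z) = y * (x * z)} := fun y z =>
    isClosed_eq (continuous_id.mul continuous_const)
      (continuous_const.mul (continuous_id.mul continuous_const))
  let S (y : J) : Submodule ℂ J :=
    { carrier := {x | x * (y * z) = y * (x * z)}
      add_mem' := fun {u v} hu hv => by
        simp only [Set.mem_ofPred_eq, add_mul, mul_add] at *
        rw [hu, hv]
      zero_mem' := by simp
      smul_mem' := fun c u hu => by
        simp only [Set.mem_ofPred_eq, smul_mul_assoc, mul_smul_comm] at *
        rw [hu] }
  have h1 : ∀ n, ∀ y ∈ powerSpan a,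
      y * (jordanPow a n * z) = jordanPow a n * (y * z) := fun n y hy =>
    powerSpan_le (S := S (jordanPow a n)) (closedEq _ _)
      (fun m => jordanPow_mul_left_comm a m n z) hy
  exact powerSpan_le (S := S y) (closedEq _ _) (fun n => (h1 n y hy).symm) hx

theorem star_jordanPow {a : J} (ha : IsSelfAdjoint a) (n : ℕ) :
    star (jordanPow a n) = jordanPow a n := by
  induction n with
  | zero => exact ha
  | succ n ih => rw [jordanPow, star_mul, ih, ha.star_eq, mul_comm]

theorem star_mem_powerSpan {a x : J} (ha : IsSelfAdjoint a) (hx : x ∈ powerSpan a) :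
    star x ∈ powerSpan a := by
  let S : Submodule ℂ J :=
    { carrier := {x | star x ∈ powerSpan a}
      add_mem' := fun {u v} hu hv => by
        simp only [Set.mem_ofPred_eq, star_add] at *
        exact add_mem hu hv
      zero_mem' := by simp
      smul_mem' := fun c u hu => by
        simp only [Set.mem_ofPred_eq, star_smul] at *
        exact Submodule.smul_mem _ _ hu }
  exact powerSpan_le (S := S) ((isClosed_powerSpan a).preimage continuous_star)
    (fun n => by
      change star (jordanPow a n) ∈ powerSpan a
      rw [star_jordanPow ha]
      exact jordanPow_mem_powerSpan a n) hx

/-- The closed `⋆`-subalgebra generated by a self-adjoint element. -/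
noncomputable def powerAlgebra (a : selfAdjoint J) : NonUnitalStarSubalgebra ℂ J :=
  { powerSpan (a : J) with
    mul_mem' := mul_mem_powerSpan
    star_mem' := star_mem_powerSpan a.2 }

theorem powerAlgebra_mul_left_comm {a : selfAdjoint J} (x y : powerAlgebra a) (z : J) :
    (x : J) * (y * z) = y * (x * z) :=
  mul_left_comm_of_mem_powerSpan x.2 y.2 z

theorem powerAlgebra_mul_assoc {a : selfAdjoint J} (x y z : powerAlgebra a) :
    x * y * z = x * (y * z) := by
  refine Subtype.ext ?_
  change (x : J) * y * z = x * (y * z)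
  rw [mul_comm (x * y : J), powerAlgebra_mul_left_comm z x, mul_comm (z : J)]

/-- By associativity the cubic norm axiom reads `‖x⋆xx‖ = ‖x‖³`; submultiplicativity and division by
`‖x‖` give the C⋆-inequality. -/
theorem norm_mul_self_le_norm_star_mul {a : selfAdjoint J} (x : powerAlgebra a) :
    ‖(x : J)‖ * ‖(x : J)‖ ≤ ‖star (x : J) * x‖ := by
  have h1 : (2 : ℂ) • (((x : J) * star (x : J)) * x) - ((x : J) * x) * star (x : J) =
      star (x : J) * x * x := by
    have h2 : (x : J) * x * star (x : J) = star (x : J) * x * x := by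
      rw [mul_comm, mul_comm (star (x : J) * x)]
      exact powerAlgebra_mul_left_comm (star x) x x
    rw [h2, mul_comm (x : J) (star (x : J)), two_smul, add_sub_cancel_right]
  have h3 := norm_triple' (x : J)
  rw [h1] at h3
  have h4 := norm_mul_le' (star (x : J) * x) x
  rw [h3] at h4
  rcases (norm_nonneg (x : J)).eq_or_lt with h | h
  · rw [← h, MulZeroClass.zero_mul]; exact norm_nonneg _
  · refine le_of_mul_le_mul_right ?_ h
    calc _ = ‖(x : J)‖ ^ 3 := by ring
      _ ≤ _ := h4

noncomputable instance (a : selfAdjoint J) : NonUnitalNormedCommRing (powerAlgebra a) where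
  __ := (inferInstance : NonUnitalNonAssocRing (powerAlgebra a))
  __ := (inferInstance : NormedAddCommGroup (powerAlgebra a))
  mul_assoc := powerAlgebra_mul_assoc
  mul_comm x y := Subtype.ext (mul_comm (x : J) y)
  norm_mul_le x y := norm_mul_le' (x : J) y

noncomputable instance (a : selfAdjoint J) : NonUnitalCommCStarAlgebra (powerAlgebra a) where
  __ := (inferInstance : StarRing (powerAlgebra a))
  __ := (inferInstance : NormedSpace ℂ (powerAlgebra a))
  __ := (inferInstance : StarModule ℂ (powerAlgebra a))
  __ := (inferInstance : IsScalarTower ℂ (powerAlgebra a) (powerAlgebra a))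
  __ := (inferInstance : SMulCommClass ℂ (powerAlgebra a) (powerAlgebra a))
  toCompleteSpace := (isClosed_powerSpan (a : J)).completeSpace_coe
  norm_mul_self_le := norm_mul_self_le_norm_star_mul
  mul_comm := mul_comm

/-- The first term of the triple product vanishes; the other two cancel because multiplications by
`x` and `y` commute on `J`. -/
theorem orthogonal_of_mul_eq_zero {a : selfAdjoint J} {x y : powerAlgebra a}
    (hy : IsSelfAdjoint (y : J)) (h : (x : J) * y = 0) : Orthogonal (x : J) (y : J) := by
  intro c
  rw [triple, hy.star_eq, h, zero_mul, zero_add, mul_comm (c * y : J), mul_comm c,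
    powerAlgebra_mul_left_comm x y, mul_comm (y : J), sub_self]

end JBStarAlgebra

/-! ### Polarization and complexification -/

namespace JBStarAlgebra

variable {J : Type*} [JBStarAlgebra J]

theorem Form.apply_mul_self {V : Form J} (hanti : V.IsAntiSymmetric)
    (horth : V.IsOrthogonalOnSelfAdjoint) (a : selfAdjoint J) :
    V (a : J) ((a : J) * a) = 0 := by
  let ι : powerAlgebra a →L[ℂ] J := (powerSpan (a : J)).subtypeL
  let W : powerAlgebra a →L[ℂ] powerAlgebra a →L[ℂ] ℂ := V.bilinearComp ι ι
  let b : powerAlgebra a := ⟨a, self_mem_powerSpan (a : J)⟩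
  have hsa : ∀ x : powerAlgebra a, IsSelfAdjoint x → IsSelfAdjoint (x : J) := fun x hx =>
    congrArg Subtype.val hx
  exact apply_mul_self_eq_zero_of_antisymm_of_orthogonal W (fun x y => hanti x y)
    (fun x y hx hy h => horth x y (hsa x hx) (hsa y hy)
      (orthogonal_of_mul_eq_zero (hsa y hy) (congrArg Subtype.val h)))
    (a := b) (Subtype.ext a.2)

theorem Form.apply_mul_of_selfAdjoint {V : Form J} (hanti : V.IsAntiSymmetric)
    (horth : V.IsOrthogonalOnSelfAdjoint) (a b c : selfAdjoint J) :
    V ((a : J) * b) c = V (a : J) (b * c) + V (b : J) (a * c) := by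
  have h := Form.apply_mul_self hanti horth
  have h1 := h a
  have h2 := h b
  have h3 := h c
  have h12 := h (a + b)
  have h13 := h (a + c)
  have h23 := h (b + c)
  have h123 := h (a + b + c)
  rw [hanti ((a : J) * b) c]
  simp only [AddSubgroup.coe_add, map_add, add_apply, mul_add, add_mul, mul_comm (b : J) a,
    mul_comm (c : J) a, mul_comm (c : J) b] at h12 h13 h23 h123 ⊢
  -- Inclusion-exclusion isolates the trilinear part, in which each of the three terms occurs twice.
  linear_combination (-1 / 2 : ℂ) * (h123 - h12 - h13 - h23 + h1 + h2 + h3)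

theorem Form.apply_mul {V : Form J} (hanti : V.IsAntiSymmetric)
    (horth : V.IsOrthogonalOnSelfAdjoint) (a b c : J) :
    V (a * b) c = V a (b * c) + V b (a * c) := by
  have h := Form.apply_mul_of_selfAdjoint hanti horth
  have hc : ∀ (x y : selfAdjoint J) (c : J),
      V ((x : J) * y) c = V (x : J) (y * c) + V (y : J) (x * c) := by
    intro x y c
    rw [← realPart_add_I_smul_imaginaryPart c]
    simp only [map_add, map_smul, mul_add, mul_smul_comm, h, smul_eq_mul]
    ring
  have hb : ∀ (x : selfAdjoint J) (b c : J),
      V ((x : J) * b) c = V (x : J) (b * c) + V b (x * c) := by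
    intro x b c
    rw [← realPart_add_I_smul_imaginaryPart b]
    simp only [map_add, map_smul, mul_add, add_mul, mul_smul_comm, smul_mul_assoc, hc,
      smul_eq_mul, add_apply, smul_apply]
    ring
  rw [← realPart_add_I_smul_imaginaryPart a]
  simp only [map_add, map_smul, mul_add, add_mul, smul_mul_assoc, hb,
    smul_eq_mul, add_apply, smul_apply]
  ring

end JBStarAlgebra

theorem mainTheorem6 {J : Type*} [JBStarAlgebra J] (V : JBStarAlgebra.Form J)
    (hanti : V.IsAntiSymmetric) (horth : V.IsOrthogonalOnSelfAdjoint) :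
    JBStarAlgebra.IsJordanDerivation V.toDual := by
  intro a b
  ext c
  exact JBStarAlgebra.Form.apply_mul hanti horth a b c
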